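/- Let $X$ be a reflexive real Banach space with continuous dual $X^*$, bidual $X^{**}$ and third dual $X^{***}$. For a set-valued operator $T\colon E\rightrightarrows E^*$ on a real Banach space $E$ write $\operatorname{gra}T=\{(x,x^*)\in E\times E^* : x^*\in Tx\}$. Call $T$ monotone if $\langle x-y,x^*-y^*\rangle\ge 0$ for all $(x,x^*),(y,y^*)\in\operatorname{gra}T$, and maximally monotone if it is monotone and every monotone $B\colon E\rightrightarrows E^*$ with $\operatorname{gra}T\subseteq\operatorname{gra}B$ satisfies $\operatorname{gra}T=\operatorname{gra}B$. Let $A\colon X\rightrightarrows X^*$ be a monotone linear relation (that is, $A$ is monotone and $\operatorname{gra}A$ is a linear subspace of $X\times X^*$) whose graph is closed in the norm topology of $X\times X^*$. Its adjoint $A^*$ is given by $$\operatorname{gra}A^*=\{(x^{**},x^*)\in X^{**}\times X^* : \langle a,x^*\rangle-\langle a^*,x^{**}\rangle=0\ \text{ for all }(a,a^*)\in\operatorname{gra}A\},$$ and is regarded as an operator $X^{**}\rightrightarrows X^{***}$ through the canonical embedding $X^*\hookrightarrow X^{***}$. Then the following are equivalent: 1. $A$ is maximally monotone. 2. $A^*$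 is maximally monotone. 3. $A^*$ is monotone. -/

import Mathlib

namespace MonotoneOperator

/-- A real normed space is reflexive if the canonical embedding into its bidual is onto. -/
def IsReflexive (X : Type*) [NormedAddCommGroup X] [NormedSpace ℝ X] : Prop :=
  Function.Surjective (NormedSpace.inclusionInDoubleDual ℝ X)

/-- The graph of a set-valued operator. -/
def gra {E F : Type*} (A : E → Set F) : Set (E × F) :=
  {p | p.2 ∈ A p.1}

/-- A set-valued operator is a linear relation if its graph is a linear subspace. -/
def IsLinearRelation {E F : Type*} [AddCommGroup E] [Module ℝ E] [AddCommGroup F] [Module ℝ F]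
    (A : E → Set F) : Prop :=
  ∃ W : Submodule ℝ (E × F), (W : Set (E × F)) = gra A

/-- Monotonicity of a set-valued operator from a normed space `E` to its continuous dual. -/
def IsMonotone {E : Type*} [NormedAddCommGroup E] [NormedSpace ℝ E]
    (A : E → Set (StrongDual ℝ E)) : Prop :=
  ∀ p ∈ gra A, ∀ q ∈ gra A, 0 ≤ (p.2 - q.2) (p.1 - q.1)

/-- Maximal monotonicity: `A` is monotone and no monotone operator has a strictly larger graph. -/
def IsMaximallyMonotone {E : Type*} [NormedAddCommGroup E] [NormedSpace ℝ E]
    (A : E → Set (StrongDual ℝ E)) : Prop :=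
  IsMonotone A ∧
    ∀ B : E → Set (StrongDual ℝ E), IsMonotone B → gra A ⊆ gra B → gra A = gra B

/-- The annihilator of a subset of `Z` in the continuous dual of `Z`. -/
def annihilator {Z : Type*} [NormedAddCommGroup Z] [NormedSpace ℝ Z] (S : Set Z) :
    Set (StrongDual ℝ Z) :=
  {f | ∀ s ∈ S, f s = 0}

/-- The adjoint, as a set-valued operator from the bidual of `X` to the dual of `X`:
`(x'', x')` is in its graph iff `(x', -x'')` annihilates the graph of `A`, where a pair `(y', y'')`
is identified with the functional `(x, x') ↦ y' x + y'' x'` on `X × StrongDual ℝ X`. -/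
def adjoint {X : Type*} [NormedAddCommGroup X] [NormedSpace ℝ X] (A : X → Set (StrongDual ℝ X)) :
    StrongDual ℝ (StrongDual ℝ X) → Set (StrongDual ℝ X) :=
  fun x'' => {x' | ContinuousLinearMap.coprod x' (-x'') ∈ annihilator (gra A)}

/-- The adjoint, as a set-valued operator from the bidual of `X` to the dual of the bidual, through
the canonical embedding of the dual of `X` into its own bidual. This is the form in which
monotonicity of the adjoint makes sense. -/
def adjointOp {X : Type*} [NormedAddCommGroup X] [NormedSpace ℝ X] (A : X → Set (StrongDual ℝ X)) :
    StrongDual ℝ (StrongDual ℝ X) → Set (StrongDual ℝ (StrongDual ℝ (StrongDual ℝ X))) :=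
  fun x'' => NormedSpace.inclusionInDoubleDual ℝ (StrongDual ℝ X) '' adjoint A x''

end MonotoneOperator

namespace MonotoneOperator

/-! The engine is a criterion needing no reflexivity: a closed monotone linear relation `G` with
monotone adjoint contains every `z` monotonically related to it. On `G - z` minimise half the
squared norm plus the pairing. Fenchel duality supplies a dual functional; at near-minimizers the
optimality conditions nearly produce an element of the adjoint, whose monotonicity forces the
near-minimizers to tend to `0`, so `z ∈ G` by closedness (`mem_of_monotonically_related`). This is 3
→ 1.

For 3 → 2 the same criterion is applied to `A*`: in the reflexive case `A** = A` up to canonical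
embeddings, so the adjoint of `A*` is monotone. For 1 → 3, a negative pairing in the adjoint would
yield a point that can be added to `A`. -/

/-! ### Convex duality -/

/-- Fenchel duality: a continuous convex function and a convex function on a nonempty convex set
whose sum is bounded below by `m` are separated by a continuous affine function. -/
theorem exists_strongDual_of_le_add {F : Type*} [NormedAddCommGroup F] [NormedSpace ℝ F]
    {N q : F → ℝ} {C : Set F} {m : ℝ} (hN : ConvexOn ℝ Set.univ N) (hNc : Continuous N)
    (hq : ConvexOn ℝ C q) (hC : C.Nonempty) (h : ∀ g ∈ C, m ≤ N g + q g) :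
    ∃ y : StrongDual ℝ F, ∀ w, ∀ g ∈ C, y w - N w ≤ y g + q g - m := by
  have h1 : Convex ℝ {p : F × ℝ | p.1 ∈ Set.univ ∧ N p.1 < p.2} := hN.convex_strict_epigraph
  have h1o : IsOpen {p : F × ℝ | p.1 ∈ Set.univ ∧ N p.1 < p.2} := by
    simp only [Set.mem_univ, true_and]
    exact isOpen_lt (hNc.comp continuous_fst) continuous_snd
  have h2 : Convex ℝ {p : F × ℝ | p.1 ∈ C ∧ p.2 ≤ m - q p.1} := by
    have : ConcaveOn ℝ C (fun x => m - q x) := (concaveOn_const m hq.1).sub hq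
    exact this.convex_hypograph
  have hd : Disjoint {p : F × ℝ | p.1 ∈ Set.univ ∧ N p.1 < p.2}
      {p : F × ℝ | p.1 ∈ C ∧ p.2 ≤ m - q p.1} := by
    rw [Set.disjoint_left]
    rintro p ⟨-, hp⟩ ⟨hpC, hp'⟩
    linarith [h _ hpC]
  obtain ⟨f, u, hf1, hf2⟩ := geometric_hahn_banach_open h1 h1o h2 hd
  obtain ⟨y, c, hyc⟩ : ∃ (y : StrongDual ℝ F) (c : ℝ), ∀ w r, f (w, r) = y w + c * r := by
    refine ⟨f.comp (ContinuousLinearMap.inl ℝ F ℝ), f (0, 1), fun w r => ?_⟩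
    have : ((w, r) : F × ℝ) = (w, 0) + r • (0, 1) := by simp
    rw [this, map_add, map_smul]
    simp [mul_comm]
  have k1 : ∀ w r, N w < r → y w + c * r < u := fun w r hr => by
    rw [← hyc]; exact hf1 (w, r) ⟨trivial, hr⟩
  have k2 : ∀ g ∈ C, u ≤ y g + c * (m - q g) := fun g hg => by
    rw [← hyc]; exact hf2 (g, m - q g) ⟨hg, le_rfl⟩
  obtain ⟨g₀, hg₀⟩ := hC
  have hc : c < 0 := by
    -- The height is `N g₀ + 1`, written so that comparison with `a2` leaves `c` times a quantity at
    -- least `1`: the separating hyperplane is not vertical.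
    have a1 := k1 g₀ (N g₀ + q g₀ - m + 1 + (m - q g₀)) (by linarith)
    have a2 := k2 g₀ hg₀
    have a3 := h g₀ hg₀
    by_contra! hc
    nlinarith [mul_nonneg hc (by linarith : 0 ≤ N g₀ + q g₀ - m + 1)]
  have k1' : ∀ w, y w + c * N w ≤ u := fun w => by
    have ht : Filter.Tendsto (fun r => y w + c * r) (nhdsWithin (N w) (Set.Ioi (N w)))
        (nhds (y w + c * N w)) :=
      ((by fun_prop : Continuous fun r => y w + c * r).tendsto _).mono_left nhdsWithin_le_nhds
    exact le_of_tendsto ht (Filter.eventually_of_mem self_mem_nhdsWithin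
      fun r hr => (k1 w r hr).le)
  refine ⟨(-c)⁻¹ • y, fun w g hg => ?_⟩
  have a := (k1' w).trans (k2 g hg)
  have hc' : 0 < -c := by linarith
  simp only [smul_apply, smul_eq_mul]
  have hcc : (-c)⁻¹ * c = -1 := by rw [inv_neg, neg_mul, inv_mul_cancel₀ hc.ne]
  have e1 : (-c)⁻¹ * y w - N w = (-c)⁻¹ * (y w + c * N w) := by
    linear_combination -N w * hcc
  have e2 : (-c)⁻¹ * y g + q g - m = (-c)⁻¹ * (y g + c * (m - q g)) := by
    linear_combination (q g - m) * hcc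
  rw [e1, e2]
  exact mul_le_mul_of_nonneg_left a (by positivity)

/-- The conjugate of half the squared norm is half the squared dual norm. -/
theorem half_sq_norm_le_of_forall {F : Type*} [NormedAddCommGroup F] [NormedSpace ℝ F]
    {y : StrongDual ℝ F} {c : ℝ} (h : ∀ w, y w - 1 / 2 * ‖w‖ ^ 2 ≤ c) :
    1 / 2 * ‖y‖ ^ 2 ≤ c := by
  have hc : 0 ≤ c := by simpa using h 0
  have : ‖y‖ ≤ √(2 * c) := by
    refine y.opNorm_le_bound (Real.sqrt_nonneg _) fun w => ?_
    have hd : discrim (1 / 2 * ‖w‖ ^ 2) (-(y w)) c ≤ 0 := by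
      refine discrim_le_zero fun t => ?_
      have := h (t • w)
      rw [map_smul, norm_smul, mul_pow, Real.norm_eq_abs, sq_abs, smul_eq_mul] at this
      linarith
    rw [discrim] at hd
    rw [Real.norm_eq_abs]
    refine abs_le_of_sq_le_sq ?_ (by positivity)
    rw [mul_pow, Real.sq_sqrt (by positivity)]
    linarith
  have h2 := pow_le_pow_left₀ (norm_nonneg y) this 2
  rw [Real.sq_sqrt (by positivity)] at h2
  linarith

/-! ### The maximality criterion -/

section

variable {E : Type*} [NormedAddCommGroup E] [NormedSpace ℝ E]

theorem convexOn_half_sq_norm_add :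
    ConvexOn ℝ Set.univ
      (fun w : E × StrongDual ℝ E => 1 / 2 * ‖w.1‖ ^ 2 + 1 / 2 * ‖w.2‖ ^ 2) := by
  have sq : ∀ (F : Type _) [NormedAddCommGroup F] [NormedSpace ℝ F],
      ConvexOn ℝ Set.univ (fun x : F => 1 / 2 * ‖x‖ ^ 2) := fun F _ _ =>
    ((convexOn_univ_norm (E := F)).pow (fun _ _ => norm_nonneg _) 2).smul (by norm_num)
  exact ((sq E).comp_linearMap (LinearMap.fst ℝ E (StrongDual ℝ E))).add
    ((sq (StrongDual ℝ E)).comp_linearMap (LinearMap.snd ℝ E (StrongDual ℝ E)))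

/-- Differences of points of `G - z` lie in `G`, and the convexity defect of the pairing is `a * b`
times its value at such a difference. -/
theorem convexOn_pairing {G : Submodule ℝ (E × StrongDual ℝ E)} (hG : ∀ p ∈ G, 0 ≤ p.2 p.1)
    (z : E × StrongDual ℝ E) :
    ConvexOn ℝ {g | g + z ∈ G} (fun g : E × StrongDual ℝ E => g.2 g.1) := by
  refine ⟨?_, ?_⟩
  · intro g hg h hh a b _ _ hab
    have : a • g + b • h + z = a • (g + z) + b • (h + z) := by
      rw [smul_add, smul_add, add_add_add_comm, ← add_smul, hab, one_smul]
    simp only [Set.mem_ofPred_eq, this]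
    exact G.add_mem (G.smul_mem _ hg) (G.smul_mem _ hh)
  · intro g hg h hh a b ha hb hab
    have hs : g - h ∈ G := by
      have := G.sub_mem hg hh
      rwa [add_sub_add_right_eq_sub] at this
    have h0 := mul_nonneg (mul_nonneg ha hb) (hG _ hs)
    obtain rfl : b = 1 - a := by linarith
    simp only [Prod.snd_sub, Prod.fst_sub, map_sub, sub_apply, Prod.snd_add,
      Prod.fst_add, Prod.smul_fst, Prod.smul_snd, map_add, map_smul, smul_eq_mul,
      add_apply, smul_apply] at h0 ⊢
    linarith

/-- Near-minimizers of a quadratic function on an affine space are nearly stationary. -/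
theorem sq_le_of_forall_quadratic {a b ε : ℝ} (h : ∀ t : ℝ, 0 ≤ t ^ 2 * a + t * b + ε) :
    b ^ 2 ≤ 4 * a * ε := by
  have := discrim_le_zero (a := a) (b := b) (c := ε) (fun t => by linarith [h t])
  rw [discrim] at this
  linarith

/-- A closed monotone linear relation with monotone adjoint is maximally monotone: a point
monotonically related to it belongs to it. -/
theorem mem_of_monotonically_related {G : Submodule ℝ (E × StrongDual ℝ E)}
    (hcl : IsClosed (G : Set (E × StrongDual ℝ E))) (hG : ∀ p ∈ G, 0 ≤ p.2 p.1)
    (hadj : ∀ (x'' : StrongDual ℝ (StrongDual ℝ E)) (x' : StrongDual ℝ E),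
      (∀ p ∈ G, x' p.1 = x'' p.2) → 0 ≤ x'' x')
    {z : E × StrongDual ℝ E} (hz : ∀ p ∈ G, 0 ≤ (p.2 - z.2) (p.1 - z.1)) : z ∈ G := by
  set N : E × StrongDual ℝ E → ℝ := fun w => 1 / 2 * ‖w.1‖ ^ 2 + 1 / 2 * ‖w.2‖ ^ 2 with hNdef
  set q : E × StrongDual ℝ E → ℝ := fun g => g.2 g.1 with hqdef
  set C : Set (E × StrongDual ℝ E) := {g | g + z ∈ G} with hCdef
  have hC : C.Nonempty := ⟨-z, by simp [hCdef]⟩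
  have hq0 : ∀ g ∈ C, 0 ≤ q g := fun g hg => by simpa using hz _ hg
  have hN0 : ∀ g, 0 ≤ N g := fun g => by positivity
  obtain ⟨m, hm⟩ : ∃ m, IsGLB ((fun g => N g + q g) '' C) m :=
    Real.exists_isGLB (hC.image _) ⟨0, by
      rintro _ ⟨g, hg, rfl⟩
      exact add_nonneg (hN0 g) (hq0 g hg)⟩
  have hle : ∀ g ∈ C, m ≤ N g + q g := fun g hg => hm.1 ⟨g, hg, rfl⟩
  obtain ⟨y, hy⟩ := exists_strongDual_of_le_add convexOn_half_sq_norm_add (by fun_prop)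
    (convexOn_pairing hG z) hC hle
  obtain ⟨y₁, y₂, hy12⟩ : ∃ (y₁ : StrongDual ℝ E) (y₂ : StrongDual ℝ (StrongDual ℝ E)),
      ∀ w, y w = y₁ w.1 + y₂ w.2 := by
    refine ⟨y.comp (.inl ℝ _ _), y.comp (.inr ℝ _ _), fun w => ?_⟩
    simp [← map_add]
  have hconj : ∀ g ∈ C, 1 / 2 * ‖y₁‖ ^ 2 + 1 / 2 * ‖y₂‖ ^ 2 ≤ y g + q g - m := by
    intro g hg
    have h1 : ∀ w₂, 1 / 2 * ‖y₁‖ ^ 2 ≤ y g + q g - m - (y₂ w₂ - 1 / 2 * ‖w₂‖ ^ 2) := fun w₂ =>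
      half_sq_norm_le_of_forall fun w₁ => by
        have : y (w₁, w₂) - (1 / 2 * ‖w₁‖ ^ 2 + 1 / 2 * ‖w₂‖ ^ 2) ≤ _ := hy (w₁, w₂) g hg
        rw [hy12 (w₁, w₂)] at this
        dsimp only at this
        linarith
    have h2 : 1 / 2 * ‖y₂‖ ^ 2 ≤ y g + q g - m - 1 / 2 * ‖y₁‖ ^ 2 :=
      half_sq_norm_le_of_forall fun w₂ => by linarith [h1 w₂]
    linarith
  have hy0 : ‖y₂ y₁‖ ≤ 1 / 2 * ‖y₁‖ ^ 2 + 1 / 2 * ‖y₂‖ ^ 2 := by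
    have := y₂.le_opNorm y₁
    nlinarith [sq_nonneg (‖y₁‖ - ‖y₂‖)]
  have key : ∀ δ : ℝ, 0 < δ → ∀ p ∈ C, N p + q p ≤ m + δ ^ 2 →
      ‖p‖ ^ 2 ≤ 52 * δ ^ 2 + 8 * δ * (‖y₁‖ + ‖y₂‖) := by
    intro δ hδ p hp hpm
    -- `(a, b)` is the derivative at `p` of the pairing plus `y`; near-optimality makes it small on
    -- `G`.
    set a : StrongDual ℝ E := p.2 + y₁ with ha
    set b : StrongDual ℝ (StrongDual ℝ E) :=
      NormedSpace.inclusionInDoubleDual ℝ E p.1 + y₂ with hb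
    have hD : ∀ v ∈ G, ‖a.coprod b v‖ ≤ 2 * δ * ‖v‖ := by
      intro v hv
      have h1 : (a.coprod b v) ^ 2 ≤ 4 * q v * δ ^ 2 := by
        refine sq_le_of_forall_quadratic fun t => ?_
        have hpt : p + t • v ∈ C := by
          have := G.add_mem hp (G.smul_mem t hv)
          rwa [add_right_comm] at this
        have h2 := hy p _ hpt
        rw [hy12 p, hy12 (p + t • v)] at h2
        simp only [hqdef, ha, hb, hNdef, ContinuousLinearMap.coprod_apply, add_apply, smul_apply,
          Prod.fst_add, Prod.snd_add, Prod.smul_fst, Prod.smul_snd, map_add, map_smul, smul_eq_mul,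
          NormedSpace.dual_def] at h2 hpm ⊢
        linarith
      have h2 : q v ≤ ‖v‖ ^ 2 := by
        calc q v ≤ ‖v.2‖ * ‖v.1‖ := (le_abs_self _).trans (v.2.le_opNorm v.1)
          _ ≤ ‖v‖ * ‖v‖ := by gcongr; exacts [norm_snd_le v, norm_fst_le v]
          _ = ‖v‖ ^ 2 := (sq _).symm
      rw [Real.norm_eq_abs]
      refine abs_le_of_sq_le_sq ?_ (by positivity)
      nlinarith [mul_le_mul_of_nonneg_right h2 (sq_nonneg δ)]
    -- Subtracting a small Hahn–Banach extension `e` makes `(a, b)` annihilate `G` exactly, giving a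
    -- point of the adjoint.
    obtain ⟨e, he, hen⟩ := exists_extension_norm_eq G ((a.coprod b).comp G.subtypeL)
    have hen' : ‖e‖ ≤ 2 * δ := by
      rw [hen]
      exact ContinuousLinearMap.opNorm_le_bound _ (by positivity) fun v => hD v v.2
    set e₁ := e.comp (.inl ℝ E (StrongDual ℝ E))
    set e₂ := e.comp (.inr ℝ E (StrongDual ℝ E))
    have he₁ : ‖e₁‖ ≤ 2 * δ := by
      refine ContinuousLinearMap.opNorm_le_bound _ (by positivity) fun v => ?_
      simpa [e₁] using e.le_of_opNorm_le hen' (v, 0)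
    have he₂ : ‖e₂‖ ≤ 2 * δ := by
      refine ContinuousLinearMap.opNorm_le_bound _ (by positivity) fun v => ?_
      simpa [e₂] using e.le_of_opNorm_le hen' (0, v)
    have hmon : 0 ≤ (-(b - e₂)) (a - e₁) := by
      refine hadj _ _ fun v hv => ?_
      have h1 : e v = a v.1 + b v.2 := by simpa using he ⟨v, hv⟩
      have h2 : e v = e₁ v.1 + e₂ v.2 := by simp [e₁, e₂, ← map_add]
      simp only [neg_apply, sub_apply]
      linarith
    have hexp : b a ≤ b e₁ + e₂ a - e₂ e₁ := by
      simp only [neg_apply, sub_apply, map_sub] at hmon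
      linarith
    have hba : b a = q p + y p + y₂ y₁ := by
      rw [hy12]
      simp only [ha, hb, hqdef, add_apply, map_add, NormedSpace.dual_def]
      ring
    have hna : ‖a‖ ≤ ‖p.2‖ + ‖y₁‖ := norm_add_le _ _
    have hnb : ‖b‖ ≤ ‖p.1‖ + ‖y₂‖ := by
      have h1 := norm_add_le (NormedSpace.inclusionInDoubleDual ℝ E p.1) y₂
      have h2 := NormedSpace.double_dual_bound ℝ E p.1
      exact h1.trans (add_le_add h2 le_rfl)
    have b1 : b e₁ ≤ (‖p.1‖ + ‖y₂‖) * (2 * δ) :=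
      (le_abs_self _).trans ((b.le_opNorm e₁).trans (by gcongr))
    have b2 : e₂ a ≤ 2 * δ * (‖p.2‖ + ‖y₁‖) :=
      (le_abs_self _).trans ((e₂.le_opNorm a).trans (by gcongr))
    have b3 : -(e₂ e₁) ≤ 2 * δ * (2 * δ) :=
      (neg_le_abs _).trans ((e₂.le_opNorm e₁).trans (by gcongr))
    have b4 := neg_le_abs (y₂ y₁)
    rw [← Real.norm_eq_abs] at b4
    have b5 := hconj p hp
    have b6 := hq0 p hp
    -- By `hconj` and `hy0`, `m ≤ b a`, while `hexp` bounds `b a` by terms of order `δ`; hence `N p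
    -- ≤ m + δ ^ 2` is small.
    have b7 : 1 / 2 * ‖p.1‖ ^ 2 + 1 / 2 * ‖p.2‖ ^ 2
        ≤ 5 * δ ^ 2 + 2 * δ * (‖p.1‖ + ‖p.2‖ + (‖y₁‖ + ‖y₂‖)) := by
      simp only [hNdef] at hpm
      linarith
    have b8 : ‖p.1‖ ^ 2 + ‖p.2‖ ^ 2 ≤ 52 * δ ^ 2 + 8 * δ * (‖y₁‖ + ‖y₂‖) := by
      -- The squares absorb the terms linear in `‖p.1‖` and `‖p.2‖`.
      nlinarith [sq_nonneg (‖p.1‖ - 4 * δ), sq_nonneg (‖p.2‖ - 4 * δ)]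
    refine le_trans ?_ b8
    rcases max_choice ‖p.1‖ ‖p.2‖ with h | h <;> rw [Prod.norm_def, h] <;>
      linarith [sq_nonneg ‖p.1‖, sq_nonneg ‖p.2‖]
  rw [← SetLike.mem_coe, ← hcl.closure_eq, Metric.mem_closure_iff]
  intro η hη
  obtain ⟨δ, hδη, hδ⟩ : ∃ δ : ℝ, 52 * δ ^ 2 + 8 * δ * (‖y₁‖ + ‖y₂‖) < η ^ 2 ∧ 0 < δ := by
    have ht : Filter.Tendsto (fun δ : ℝ => 52 * δ ^ 2 + 8 * δ * (‖y₁‖ + ‖y₂‖))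
        (nhdsWithin 0 (Set.Ioi 0)) (nhds (52 * 0 ^ 2 + 8 * 0 * (‖y₁‖ + ‖y₂‖))) :=
      ((by fun_prop : Continuous fun δ : ℝ => 52 * δ ^ 2 + 8 * δ * (‖y₁‖ + ‖y₂‖)).tendsto
        0).mono_left nhdsWithin_le_nhds
    exact ((ht.eventually_lt_const (by simp; positivity)).and self_mem_nhdsWithin).exists
  obtain ⟨-, ⟨p, hp, rfl⟩, -, hpm⟩ := hm.exists_between (lt_add_of_pos_right m (pow_pos hδ 2))
  refine ⟨p + z, hp, ?_⟩
  rw [dist_comm, dist_eq_norm, add_sub_cancel_right]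
  exact lt_of_pow_lt_pow_left₀ 2 hη.le ((key δ hδ p hp hpm.le).trans_lt hδη)

/-! ### Monotonicity of the adjoint -/

theorem mem_adjoint_iff {A : E → Set (StrongDual ℝ E)} {x'' : StrongDual ℝ (StrongDual ℝ E)}
    {x' : StrongDual ℝ E} : x' ∈ adjoint A x'' ↔ ∀ p ∈ gra A, x' p.1 = x'' p.2 := by
  simp [adjoint, annihilator, add_neg_eq_zero]

theorem isMaximallyMonotone_of_adjoint {A : E → Set (StrongDual ℝ E)} (hmono : IsMonotone A)
    (hlin : IsLinearRelation A) (hclosed : IsClosed (gra A))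
    (hadj : ∀ x'' x', x' ∈ adjoint A x'' → 0 ≤ x'' x') : IsMaximallyMonotone A := by
  obtain ⟨W, hW⟩ := hlin
  have hmem : ∀ p, p ∈ W ↔ p ∈ gra A := fun p => by rw [← hW, SetLike.mem_coe]
  refine ⟨hmono, fun B hB hAB => hAB.antisymm fun z hz => ?_⟩
  rw [← hmem]
  refine mem_of_monotonically_related (by rwa [hW]) (fun p hp => ?_)
    (fun x'' x' h => hadj x'' x' ?_) fun p hp => hB p (hAB ((hmem p).1 hp)) z hz
  · simpa using hmono p ((hmem p).1 hp) 0 ((hmem 0).1 W.zero_mem)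
  · exact mem_adjoint_iff.2 fun p hp => h p ((hmem p).2 hp)

theorem isMonotone_adjointOp_iff {A : E → Set (StrongDual ℝ E)} :
    IsMonotone (E := StrongDual ℝ (StrongDual ℝ E)) (adjointOp A) ↔ ∀ x'' x', x' ∈ adjoint A x'' → 0 ≤ x'' x' := by
  constructor
  · intro h x'' x' hx
    have h0 : (0 : StrongDual ℝ E) ∈ adjoint A 0 := mem_adjoint_iff.2 (by simp)
    simpa using h (x'', NormedSpace.inclusionInDoubleDual ℝ _ x') ⟨x', hx, rfl⟩
      (0, NormedSpace.inclusionInDoubleDual ℝ _ 0) ⟨0, h0, rfl⟩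
  · rintro h ⟨x'', -⟩ ⟨x', hx, rfl⟩ ⟨y'', -⟩ ⟨y', hy, rfl⟩
    have := h (x'' - y'') (x' - y') (mem_adjoint_iff.2 fun p hp => by
      simp [mem_adjoint_iff.1 hx p hp, mem_adjoint_iff.1 hy p hp])
    rw [← map_sub]
    exact this

/-- If `(x, x')` in the adjoint had `x' x < 0`, then `(x, -x')` would be monotonically related to
`A`, since the cross terms cancel. Maximality puts it in `A`, and the adjoint relation then gives
`x' x = -x' x`, a contradiction. -/
theorem isMonotone_adjointOp_of_isMaximallyMonotone (hE : IsReflexive E)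
    {A : E → Set (StrongDual ℝ E)} (hlin : IsLinearRelation A) (hA : IsMaximallyMonotone A) :
    IsMonotone (E := StrongDual ℝ (StrongDual ℝ E)) (adjointOp A) := by
  rw [isMonotone_adjointOp_iff]
  intro x'' x' hx
  obtain ⟨x, rfl⟩ := hE x''
  rw [mem_adjoint_iff] at hx
  simp only [NormedSpace.dual_def] at hx ⊢
  by_contra! hneg
  obtain ⟨W, hW⟩ := hlin
  have h0 : (0 : E × StrongDual ℝ E) ∈ gra A := by rw [← hW]; exact W.zero_mem
  have hpos : ∀ p ∈ gra A, 0 ≤ (p.2 - -x') (p.1 - x) := fun p hp => by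
    have h1 := hA.1 p hp 0 h0
    have h2 := hx p hp
    simp only [Prod.snd_zero, Prod.fst_zero, sub_zero] at h1
    simp only [sub_apply, neg_apply, map_sub]
    linarith
  have hmem : (x, -x') ∈ gra A := by
    rw [hA.2 (fun y => {y' | (y, y') ∈ gra A ∨ (y, y') = (x, -x')}) ?_ fun p hp => Or.inl hp]
    · exact Or.inr rfl
    · rintro p (hp | hp) r (hr | hr)
      · exact hA.1 p hp r hr
      · obtain rfl : r = (x, -x') := hr
        exact hpos p hp
      · obtain rfl : p = (x, -x') := hp
        have := hpos r hr
        rw [← neg_sub, ← neg_sub x, map_neg, neg_apply, neg_neg] at this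
        exact this
      · obtain rfl : r = (x, -x') := hr
        obtain rfl : p = (x, -x') := hp
        simp
  have := hx _ hmem
  simp only [neg_apply] at this
  linarith

/-! ### Maximality of the adjoint -/

theorem IsReflexive.inclusionInDoubleDual_comp (hE : IsReflexive E)
    (w : StrongDual ℝ (StrongDual ℝ (StrongDual ℝ E))) :
    NormedSpace.inclusionInDoubleDual ℝ (StrongDual ℝ E)
      (w.comp (NormedSpace.inclusionInDoubleDual ℝ E)) = w := by
  ext x''
  obtain ⟨x, rfl⟩ := hE x''
  simp [NormedSpace.dual_def]

theorem mem_gra_adjointOp_iff (hE : IsReflexive E) {A : E → Set (StrongDual ℝ E)}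
    {p : StrongDual ℝ (StrongDual ℝ E) × StrongDual ℝ (StrongDual ℝ (StrongDual ℝ E))} :
    p ∈ gra (adjointOp A) ↔
      ∀ a ∈ gra A, p.2 (NormedSpace.inclusionInDoubleDual ℝ E a.1) = p.1 a.2 := by
  constructor
  · rintro ⟨x', hx, hxp⟩ a ha
    rw [← hxp, NormedSpace.dual_def, NormedSpace.dual_def, mem_adjoint_iff.1 hx a ha]
  · intro h
    exact ⟨_, mem_adjoint_iff.2 h, hE.inclusionInDoubleDual_comp p.2⟩

theorem exists_strongDual_ne_zero_of_notMem {F : Type*} [NormedAddCommGroup F] [NormedSpace ℝ F]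
    {W : Submodule ℝ F} (hW : IsClosed (W : Set F)) {x : F} (hx : x ∉ W) :
    ∃ f : StrongDual ℝ F, f x ≠ 0 ∧ ∀ a ∈ W, f a = 0 := by
  obtain ⟨f, u, hfx, hfW⟩ := geometric_hahn_banach_point_closed W.convex hW hx
  have hu : u < 0 := by simpa using hfW 0 W.zero_mem
  refine ⟨f, (hfx.trans hu).ne, fun a ha => ?_⟩
  by_contra hne
  -- A functional bounded below on a subspace vanishes there: otherwise rescaling attains the
  -- excluded value `u`.
  have := hfW ((u / f a) • a) (W.smul_mem _ ha)
  rw [map_smul, smul_eq_mul, div_mul_cancel₀ _ hne] at this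
  exact this.false

/-- If `F` is a copy `κ : F → E''` of the bidual of a reflexive space `E`, with `j : E → F` the
canonical embedding, and `M` is the adjoint of a closed monotone linear relation `A` on `E`, carried
over to an operator on `F`, then `M` is maximally monotone as soon as it is monotone. -/
theorem isMaximallyMonotone_of_gra_eq_adjoint (hE : IsReflexive E) {F : Type*}
    [NormedAddCommGroup F] [NormedSpace ℝ F] (κ : F →L[ℝ] StrongDual ℝ E →L[ℝ] ℝ) (j : E →L[ℝ] F)
    (hκj : ∀ x f, κ (j x) f = f x) (hκ : Function.Injective κ)
    {A : E → Set (StrongDual ℝ E)} (hmono : IsMonotone A) (hlin : IsLinearRelation A)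
    (hclosed : IsClosed (gra A)) {M : F → Set (StrongDual ℝ F)}
    (hM : ∀ p, p ∈ gra M ↔ ∀ a ∈ gra A, p.2 (j a.1) = κ p.1 a.2) (hMmono : IsMonotone M) :
    IsMaximallyMonotone M := by
  refine isMaximallyMonotone_of_adjoint hMmono ?_ ?_ fun u w hw => ?_
  · refine ⟨{ carrier := gra M, zero_mem' := ?_, add_mem' := ?_, smul_mem' := ?_ }, rfl⟩
    · intro p r hp hr
      rw [hM] at hp hr ⊢
      intro a ha
      simp [hp a ha, hr a ha]
    · rw [hM]
      simp
    · intro c p hp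
      rw [hM] at hp ⊢
      intro a ha
      simp [hp a ha]
  · have : gra M = ⋂ a ∈ gra A, {p | p.2 (j a.1) = κ p.1 a.2} := by
      ext p
      simp only [hM, Set.mem_iInter, Set.mem_ofPred_eq]
    rw [this]
    exact isClosed_biInter fun a _ => isClosed_eq (by fun_prop) (by fun_prop)
  · have hflip : ∀ v : StrongDual ℝ F, κ.flip (v.comp j) = v := fun v => by
      ext φ
      obtain ⟨x, hx⟩ := hE (κ φ)
      obtain rfl : j x = φ := hκ (by rw [← hx]; ext f; rw [hκj, NormedSpace.dual_def])
      rw [ContinuousLinearMap.flip_apply, hκj, ContinuousLinearMap.comp_apply]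
    obtain ⟨x, hx⟩ := hE (u.comp κ.flip)
    have hu : ∀ v : StrongDual ℝ F, u v = v (j x) := fun v => by
      conv_lhs => rw [← hflip v]
      exact (DFunLike.congr_fun hx (v.comp j)).symm
    obtain ⟨W, hW⟩ := hlin
    -- This is `A** ⊆ A`: a functional separating the point from `A` is, by reflexivity, an element
    -- of the adjoint up to sign, and `w` is tested against it.
    have hmem : (x, w.comp j) ∈ gra A := by
      rw [← hW, SetLike.mem_coe]
      by_contra hx
      obtain ⟨f, hfx, hf⟩ := exists_strongDual_ne_zero_of_notMem (by rwa [hW]) hx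
      have hsplit : ∀ a, f a = f.comp (.inl ℝ _ _) a.1 + f.comp (.inr ℝ _ _) a.2 := fun a => by
        simp [← map_add]
      obtain ⟨y, hy⟩ := hE (f.comp (.inr ℝ _ _))
      have hy' : ∀ g, f.comp (.inr ℝ _ _) g = g y := fun g => (DFunLike.congr_fun hy g).symm
      have key := mem_adjoint_iff.1 hw (-j y, κ.flip (f.comp (.inl ℝ _ _))) ((hM _).2 fun a ha => by
        have h2 := hf a (by rwa [← SetLike.mem_coe, hW])
        rw [hsplit, hy'] at h2
        simp only [ContinuousLinearMap.flip_apply, map_neg, neg_apply, hκj]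
        linarith)
      apply hfx
      rw [hsplit, hy']
      simp only [hu, ContinuousLinearMap.flip_apply, map_neg, hκj] at key
      rw [ContinuousLinearMap.comp_apply w j]
      linarith
    rw [hu]
    simpa using hmono _ hmem 0 (by rw [← hW]; exact W.zero_mem)

theorem isMaximallyMonotone_adjointOp (hE : IsReflexive E) {A : E → Set (StrongDual ℝ E)}
    (hmono : IsMonotone A) (hlin : IsLinearRelation A) (hclosed : IsClosed (gra A))
    (h : IsMonotone (E := StrongDual ℝ (StrongDual ℝ E)) (adjointOp A)) :
    IsMaximallyMonotone (E := StrongDual ℝ (StrongDual ℝ E)) (adjointOp A) :=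
  isMaximallyMonotone_of_gra_eq_adjoint (F := StrongDual ℝ (StrongDual ℝ E)) hE
    (ContinuousLinearMap.id ℝ _) (NormedSpace.inclusionInDoubleDual ℝ E)
    (fun x f => NormedSpace.dual_def ℝ E x f) Function.injective_id hmono hlin hclosed
    (fun _ => mem_gra_adjointOp_iff hE) h

end

end MonotoneOperator

theorem corollary4p2 {X : Type*} [NormedAddCommGroup X] [NormedSpace ℝ X] [CompleteSpace X]
    (hX : MonotoneOperator.IsReflexive X) (A : X → Set (StrongDual ℝ X))
    (hmono : MonotoneOperator.IsMonotone A)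
    (hlin : MonotoneOperator.IsLinearRelation A)
    (hclosed : IsClosed (MonotoneOperator.gra A)) :
    [MonotoneOperator.IsMaximallyMonotone A,
      MonotoneOperator.IsMaximallyMonotone (E := StrongDual ℝ (StrongDual ℝ X))
        (MonotoneOperator.adjointOp A),
      MonotoneOperator.IsMonotone (E := StrongDual ℝ (StrongDual ℝ X))
        (MonotoneOperator.adjointOp A)].TFAE := by
  tfae_have 1 → 3 := MonotoneOperator.isMonotone_adjointOp_of_isMaximallyMonotone hX hlin
  tfae_have 3 → 1 := fun h => MonotoneOperator.isMaximallyMonotone_of_adjoint hmono hlin hclosed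
    (MonotoneOperator.isMonotone_adjointOp_iff.1 h)
  tfae_have 3 → 2 := MonotoneOperator.isMaximallyMonotone_adjointOp hX hmono hlin hclosed
  tfae_have 2 → 3 := fun h => h.1
  tfae_finish
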